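/- Let $\zeta$ be the Riemann zeta function and let $\xi$ be Riemann's xi function, that is, the entire function $$\xi(s)=\tfrac12\,s(s-1)\,\pi^{-s/2}\,\Gamma\!\left(\tfrac{s}{2}\right)\zeta(s)$$ (with the removable singularities at $s=1$ and $s=0,-2,-4,\dots$ removed). The following statements are equivalent. (i) For every fixed real number $t$, the function $\sigma\mapsto|\xi(\sigma+it)|$ is strictly increasing on $1/2<\sigma<\infty$. (ii) For every fixed real number $t$, the function $\sigma\mapsto|\xi(\sigma+it)|$ is strictly decreasing on $-\infty<\sigma<1/2$. (iii) The Riemann Hypothesis is true: every nonreal zero of $\zeta$ has real part $1/2$ (equivalently, every zero of $\zeta$ other than $-2,-4,-6,\dots$ has real part $1/2$). -/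

import Mathlib

open Filter Topology

noncomputable section

/-- The product `(1/2) s (s - 1) π^(-s/2) Γ(s/2) ζ(s)` that defines Riemann's xi function. As a
function of a complex variable it has removable singularities at `s = 1` and at
`s = 0, -2, -4, …`, where a factor has a pole; Lean's values there carry no meaning. -/
def riemannXiProduct (s : ℂ) : ℂ :=
  1 / 2 * s * (s - 1) * (Real.pi : ℂ) ^ (-(1 / 2) * s) * Complex.Gamma (1 / 2 * s) * riemannZeta s

/-- Riemann's xi function: the entire function obtained from `riemannXiProduct` by removing its
singularities, that is, the limit of the product over the punctured neighbourhoods of `s`. -/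
def riemannXi (s : ℂ) : ℂ :=
  limUnder (𝓝[≠] s) riemannXiProduct

theorem riemannXiProduct_eq {s : ℂ} (h1 : s ≠ 1) (hG : ∀ n : ℕ, s ≠ -(2 * n)) :
    riemannXiProduct s = (s * (s - 1) * completedRiemannZeta₀ s + 1) / 2 := by
  have h0 : s ≠ 0 := by simpa using hG 0
  have hG' : Complex.Gammaℝ s ≠ 0 := fun h => by
    obtain ⟨n, hn⟩ := Complex.Gammaℝ_eq_zero_iff.mp h
    exact hG n hn
  have h1' : 1 - s ≠ 0 := sub_ne_zero.mpr (Ne.symm h1)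
  have e1 : -(1 / 2) * s = -s / 2 := by ring
  have e2 : 1 / 2 * s = s / 2 := by ring
  have h : riemannXiProduct s = 1 / 2 * s * (s - 1) * (Complex.Gammaℝ s * riemannZeta s) := by
    rw [riemannXiProduct, Complex.Gammaℝ_def, e1, e2]
    ring
  rw [h, riemannZeta_def_of_ne_zero h0, mul_div_cancel₀ _ hG', completedRiemannZeta_eq]
  field_simp
  ring

theorem tendsto_riemannXiProduct (s : ℂ) :
    Tendsto riemannXiProduct (𝓝[≠] s)
      (𝓝 ((s * (s - 1) * completedRiemannZeta₀ s + 1) / 2)) := by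
  have hc : Continuous fun w : ℂ => (w * (w - 1) * completedRiemannZeta₀ w + 1) / 2 := by
    have := differentiable_completedZeta₀.continuous
    fun_prop
  refine (hc.continuousAt.tendsto.mono_left nhdsWithin_le_nhds).congr' ?_
  have hG : ∀ᶠ w in 𝓝[≠] s, (Complex.Gammaℝ w)⁻¹ ≠ 0 := by
    by_contra hcon
    have hA : AnalyticOnNhd ℂ (fun w : ℂ => (Complex.Gammaℝ w)⁻¹) Set.univ :=
      Complex.differentiable_Gammaℝ_inv.differentiableOn.analyticOnNhd isOpen_univ
    have h := hA.eqOn_zero_of_preconnected_of_frequently_eq_zero isPreconnected_univ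
      (Set.mem_univ s) hcon
    simpa using h (Set.mem_univ 1)
  have h1 : ∀ᶠ w in 𝓝[≠] s, w ≠ 1 := by
    rcases eq_or_ne s 1 with rfl | hs
    · exact self_mem_nhdsWithin
    · exact (eventually_ne_nhds hs).filter_mono nhdsWithin_le_nhds
  filter_upwards [hG, h1] with w hw hw1
  refine (riemannXiProduct_eq hw1 fun n hn => hw ?_).symm
  rw [Complex.Gammaℝ_eq_zero_iff.mpr ⟨n, hn⟩, inv_zero]

/-- Closed form of the xi function on the whole plane. -/
theorem riemannXi_eq (s : ℂ) :
    riemannXi s = (s * (s - 1) * completedRiemannZeta₀ s + 1) / 2 :=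
  (tendsto_riemannXiProduct s).limUnder_eq

/-- The xi function is entire. -/
theorem differentiable_riemannXi : Differentiable ℂ riemannXi := by
  have := differentiable_completedZeta₀
  rw [funext riemannXi_eq]
  fun_prop

/-- The xi function is given by the defining product wherever the factors have no pole. -/
theorem riemannXi_eq_product {s : ℂ} (h1 : s ≠ 1) (hG : ∀ n : ℕ, s ≠ -(2 * n)) :
    riemannXi s = riemannXiProduct s := by
  rw [riemannXi_eq, riemannXiProduct_eq h1 hG]

end

/-!
The functional equation `ξ(1 - s) = ξ(s)` exchanges the two monotonicity statements, and a strictly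
monotone nonnegative function cannot reach zero in the interior of its domain, so monotonicity
excludes zeros off the critical line. The forms of the Riemann Hypothesis for nonreal and for
nontrivial zeros agree because `ξ` has no real zeros (`riemannXi_ofReal_ne_zero`); on `(0, 1)` this
follows from the integral representation of `ζ` by the fractional part.

The main point is that the Riemann Hypothesis implies monotonicity (`norm_riemannXi_sub_lt`). The
argument avoids the Hadamard product. For `h > 0` consider `G(s) = ξ(s - h) / ξ(s)` on the half-plane
`re s ≥ 1 / 2 + h / 2`, where the denominator has no zeros. On the boundary line `s` and `s - h` are
mirror images in the critical line, so `|G| = 1` there. By the Phragmén–Lindelöf principle `|G| ≤ 1`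
throughout, and `|G| < 1` in the interior since `G → 0` along the real axis. With `s = σ₂ + it` and
`h = σ₂ - σ₁` this is the claim.

Phragmén–Lindelöf needs `G` to be of order less than `2`. For `re s ≥ 2 + h`, `G` is bounded, because
the quotient of the Gamma factors is a Beta integral (`Complex.norm_Gamma_mul_le`). In the remaining
strip, `ξ` grows polynomially (`norm_riemannXi_le`), and `1 / ξ` at most exponentially
(`exists_exp_neg_le_norm_riemannXi`): the Borel–Carathéodory theorem is applied to `log ξ` on discs
that touch the critical line, and the value at the centre is bounded below by the reflection formula.
-/

/-! ### The Gamma function on vertical lines -/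

namespace Complex

/-- Moving the first argument of the Beta integral to the right or off the real axis only decreases
its absolute value, since `|t ^ (z - 1)| ≤ t ^ (x - 1)` on `(0, 1)`. -/
theorem norm_betaIntegral_le {z : ℂ} {x k : ℝ} (hx : 0 < x) (hz : x ≤ z.re) (hk : 0 < k) :
    ‖betaIntegral z k‖ ≤ ‖betaIntegral x k‖ := by
  have heq : ∀ t ∈ Set.Ioc (0:ℝ) 1, ((t : ℂ) ^ ((x : ℂ) - 1) * (1 - (t : ℂ)) ^ ((k : ℂ) - 1)) =
      ((t ^ (x - 1) * (1 - t) ^ (k - 1) : ℝ) : ℂ) := by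
    intro t ht
    rw [ofReal_mul, ofReal_cpow ht.1.le, ofReal_cpow (by linarith [ht.2])]
    push_cast
    rfl
  have key : ∀ t ∈ Set.Ioc (0:ℝ) 1, ‖((t : ℂ) ^ (z - 1) * (1 - (t : ℂ)) ^ ((k : ℂ) - 1))‖ ≤
      t ^ (x - 1) * (1 - t) ^ (k - 1) := by
    intro t ht
    have h2 : 0 ≤ (1 - t) ^ (k - 1) := Real.rpow_nonneg (by linarith [ht.2]) _
    have h1 : (1 - (t : ℂ)) ^ ((k : ℂ) - 1) = (((1 - t) ^ (k - 1) : ℝ) : ℂ) := by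
      rw [ofReal_cpow (by linarith [ht.2])]
      push_cast
      rfl
    rw [norm_mul, h1, norm_cpow_eq_rpow_re_of_pos ht.1, norm_real, Real.norm_of_nonneg h2]
    have : t ^ (z - 1).re ≤ t ^ (x - 1) :=
      Real.rpow_le_rpow_of_exponent_ge ht.1 ht.2 (by simpa using hz)
    gcongr
  have hB : betaIntegral x k = ((∫ t in (0:ℝ)..1, t ^ (x - 1) * (1 - t) ^ (k - 1) : ℝ) : ℂ) := by
    rw [betaIntegral, ← intervalIntegral.integral_ofReal]
    exact intervalIntegral.integral_congr_Ioo_of_le zero_le_one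
      fun t ht => heq t (Set.Ioo_subset_Ioc_self ht)
  have hint : IntervalIntegrable (fun t : ℝ => t ^ (x - 1) * (1 - t) ^ (k - 1))
      MeasureTheory.volume 0 1 := by
    refine (betaIntegral_convergent (u := (x : ℂ)) (v := (k : ℂ))
      (by simpa) (by simpa)).norm.congr ?_
    intro t ht
    rw [Set.uIoc_of_le zero_le_one] at ht
    change ‖_‖ = _
    rw [heq t ht, norm_real, Real.norm_of_nonneg (mul_nonneg (Real.rpow_nonneg ht.1.le _)
      (Real.rpow_nonneg (by linarith [ht.2]) _))]
  rw [hB, norm_real]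
  refine le_trans ?_ (le_abs_self _)
  exact intervalIntegral.norm_integral_le_of_norm_le zero_le_one
    (Eventually.of_forall key) hint

/-- For `k > 0` and `x > 0`, the quotient `|Γ(z) / Γ(z + k)|` is largest on `re z ≥ x` at `z = x`,
because it is `|B(z, k)| / Γ(k)`. -/
theorem norm_Gamma_mul_le {z : ℂ} {x k : ℝ} (hx : 0 < x) (hz : x ≤ z.re) (hk : 0 < k) :
    ‖Gamma z‖ * Real.Gamma (x + k) ≤ Real.Gamma x * ‖Gamma (z + k)‖ := by
  have h1 := congrArg norm (Gamma_mul_Gamma_eq_betaIntegral (s := z) (t := k)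
    (by linarith) (by simpa))
  have h2 := congrArg norm (Gamma_mul_Gamma_eq_betaIntegral (s := x) (t := k) (by simpa) (by simpa))
  have hB := norm_betaIntegral_le hx hz hk
  have pk := Real.Gamma_pos_of_pos hk
  have pxk := Real.Gamma_pos_of_pos (add_pos hx hk)
  have px := Real.Gamma_pos_of_pos hx
  rw [← ofReal_add, Gamma_ofReal, Gamma_ofReal, Gamma_ofReal] at h2
  rw [Gamma_ofReal] at h1
  simp only [norm_mul, norm_real, Real.norm_eq_abs, abs_of_pos pk, abs_of_pos pxk,
    abs_of_pos px] at h1 h2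
  refine le_of_mul_le_mul_right ?_ pk
  calc ‖Gamma z‖ * Real.Gamma (x + k) * Real.Gamma k
      = Real.Gamma (x + k) * (‖Gamma (z + k)‖ * ‖betaIntegral z k‖) := by rw [← h1]; ring
    _ ≤ Real.Gamma (x + k) * (‖Gamma (z + k)‖ * ‖betaIntegral x k‖) := by gcongr
    _ = Real.Gamma x * ‖Gamma (z + k)‖ * Real.Gamma k := by
      rw [mul_right_comm, h2]; ring

theorem norm_Gamma_le {z : ℂ} (hz : 0 < z.re) : ‖Gamma z‖ ≤ Real.Gamma z.re := by
  rw [Gamma_eq_integral hz, GammaIntegral, Real.Gamma_eq_integral hz]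
  refine (MeasureTheory.norm_integral_le_integral_norm _).trans_eq ?_
  refine MeasureTheory.setIntegral_congr_fun measurableSet_Ioi fun t ht => ?_
  rw [norm_mul, norm_cpow_eq_rpow_re_of_pos ht, norm_real,
    Real.norm_of_nonneg (Real.exp_pos _).le, sub_re, one_re]

/-- Lower bound from the reflection formula, with `|Γ(1 - iy)| ≤ Γ(1) = 1` and
`sinh u ≤ u * exp u` for `u ≥ 0`. -/
theorem exp_neg_le_norm_Gamma_one_add (y : ℝ) :
    Real.exp (-(Real.pi * |y|)) ≤ ‖Gamma (1 + y * I)‖ := by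
  rcases eq_or_ne y 0 with rfl | hy
  · simp
  have h1 := congrArg norm (Gamma_mul_Gamma_one_sub (y * I))
  have h2 := congrArg norm (Gamma_add_one (y * I) (by simpa))
  rw [norm_mul] at h1 h2
  have h3 : ‖Gamma (1 - y * I)‖ ≤ 1 := (norm_Gamma_le (by simp)).trans_eq (by simp)
  rw [add_comm (y * I : ℂ), norm_mul, norm_I, mul_one, norm_real, Real.norm_eq_abs] at h2
  have hy' : 0 < |y| := abs_pos.mpr hy
  have e : (Real.pi * (y * I) : ℂ) = ((Real.pi * y : ℝ) : ℂ) * I := by push_cast; ring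
  have h4 : ‖sin (Real.pi * (y * I))‖ ≤ Real.pi * |y| * Real.exp (Real.pi * |y|) := by
    rw [e, sin_mul_I, norm_mul, norm_I, mul_one, ← ofReal_sinh, norm_real, Real.norm_eq_abs,
      Real.abs_sinh, abs_mul, abs_of_pos Real.pi_pos]
    have := Real.add_one_le_exp (-(2 * (Real.pi * |y|)))
    have e2 : Real.exp (-(Real.pi * |y|)) =
        Real.exp (-(2 * (Real.pi * |y|))) * Real.exp (Real.pi * |y|) := by
      rw [← Real.exp_add]; ring_nf
    rw [Real.sinh_eq, e2]
    nlinarith [Real.exp_pos (Real.pi * |y|)]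
  have h5 : 0 < ‖sin (Real.pi * (y * I))‖ := by
    rw [e, sin_mul_I, norm_mul, norm_I, mul_one, ← ofReal_sinh, norm_real]
    exact norm_pos_iff.mpr (Real.sinh_ne_zero.mpr (mul_ne_zero Real.pi_ne_zero hy))
  rw [norm_div, norm_real, Real.norm_of_nonneg Real.pi_pos.le, eq_div_iff h5.ne'] at h1
  have h6 : Real.pi ≤ ‖Gamma (y * I)‖ * (Real.pi * |y| * Real.exp (Real.pi * |y|)) := by
    calc Real.pi = ‖Gamma (y * I)‖ * ‖Gamma (1 - y * I)‖ * ‖sin (Real.pi * (y * I))‖ := h1.symm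
      _ ≤ ‖Gamma (y * I)‖ * 1 * (Real.pi * |y| * Real.exp (Real.pi * |y|)) := by gcongr
      _ = _ := by ring
  have h7 : Real.pi * 1 ≤ Real.pi * (‖Gamma (1 + y * I)‖ * Real.exp (Real.pi * |y|)) := by
    rw [h2]; linarith
  rw [Real.exp_neg, inv_le_iff_one_le_mul₀ (Real.exp_pos _)]
  exact le_of_mul_le_mul_left h7 Real.pi_pos

end Complex

/-- Log-convexity of `Γ`: the slope of `log Γ` on `[x, x + k]` is at least its slope on `[x - 1, x]`,
which is `log (x - 1)`. -/
theorem Real.Gamma_mul_rpow_le_Gamma_add {x k : ℝ} (hx : 1 < x) (hk : 0 < k) :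
    Real.Gamma x * (x - 1) ^ k ≤ Real.Gamma (x + k) := by
  have h := Real.convexOn_log_Gamma.slope_mono_adjacent (x := x - 1) (y := x) (z := x + k)
    (by simpa using hx) (by simp; linarith) (by linarith) (by linarith)
  have hG : Real.Gamma x = (x - 1) * Real.Gamma (x - 1) := by
    have := Real.Gamma_add_one (s := x - 1) (by linarith)
    rwa [sub_add_cancel] at this
  have p1 := Real.Gamma_pos_of_pos (s := x - 1) (by linarith)
  have p2 := Real.Gamma_pos_of_pos (s := x) (by linarith)
  have p3 := Real.Gamma_pos_of_pos (s := x + k) (by linarith)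
  have hx1 : 0 < x - 1 := by linarith
  simp only [Function.comp_apply, sub_sub_cancel, div_one, add_sub_cancel_left] at h
  rw [le_div_iff₀ hk] at h
  have hl : Real.log (Real.Gamma x) = Real.log (x - 1) + Real.log (Real.Gamma (x - 1)) := by
    rw [hG, Real.log_mul hx1.ne' p1.ne']
  rw [← Real.log_le_log_iff (mul_pos p2 (Real.rpow_pos_of_pos hx1 _)) p3,
    Real.log_mul p2.ne' (Real.rpow_pos_of_pos hx1 _).ne', Real.log_rpow hx1]
  nlinarith

theorem Real.tendsto_Gamma_div_Gamma_add {k : ℝ} (hk : 0 < k) :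
    Tendsto (fun x => Real.Gamma x / Real.Gamma (x + k)) atTop (𝓝 0) := by
  have h : Tendsto (fun x : ℝ => (x - 1) ^ (-k)) atTop (𝓝 0) :=
    (tendsto_rpow_neg_atTop hk).comp (tendsto_atTop_add_const_right _ (-1) tendsto_id)
  refine squeeze_zero' ?_ ?_ h
  · filter_upwards [eventually_gt_atTop 0] with x hx
    exact div_nonneg (Real.Gamma_pos_of_pos hx).le (Real.Gamma_pos_of_pos (by linarith)).le
  · filter_upwards [eventually_gt_atTop 1] with x hx
    have hx1 : 0 < x - 1 := by linarith
    rw [Real.rpow_neg hx1.le, div_le_iff₀ (Real.Gamma_pos_of_pos (by linarith)), inv_mul_eq_div,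
      le_div_iff₀ (Real.rpow_pos_of_pos hx1 _)]
    exact Real.Gamma_mul_rpow_le_Gamma_add hx hk

/-! ### The zeta function: bounds right of the critical strip, and the interval `(0, 1)` -/

/-- The bound comes from `π ^ 2 / 6 - 1 < 3 / 4`. -/
theorem norm_riemannZeta_sub_one_le {s : ℂ} (hs : 2 ≤ s.re) : ‖riemannZeta s - 1‖ ≤ 3 / 4 := by
  have h2 : HasSum (fun n : ℕ => (1 : ℝ) / ((n + 2 : ℕ) : ℝ) ^ 2) (Real.pi ^ 2 / 6 - 1) := by
    have := (hasSum_nat_add_iff' 2).mpr hasSum_zeta_two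
    simpa [Finset.sum_range_succ] using this
  have hsum : Summable (fun n : ℕ => 1 / ((n : ℂ)) ^ s) := by
    rw [Complex.summable_one_div_nat_cpow]; linarith
  have hz : HasSum (fun n : ℕ => 1 / (((n + 2 : ℕ) : ℂ)) ^ s) (riemannZeta s - 1) := by
    have h := hsum.hasSum
    rw [← zeta_eq_tsum_one_div_nat_cpow (by linarith)] at h
    have := (hasSum_nat_add_iff' 2).mpr h
    have hs0 : s ≠ 0 := by rintro rfl; norm_num at hs
    simpa [Finset.sum_range_succ, hs0] using this
  have hle : ‖riemannZeta s - 1‖ ≤ Real.pi ^ 2 / 6 - 1 := by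
    rw [← hz.tsum_eq, ← h2.tsum_eq]
    refine tsum_of_norm_bounded h2.summable.hasSum fun n => ?_
    rw [norm_div, norm_one, Complex.norm_natCast_cpow_of_pos (by omega)]
    refine one_div_le_one_div_of_le (by positivity) ?_
    rw [← Real.rpow_natCast]
    exact Real.rpow_le_rpow_of_exponent_le (by norm_cast; omega) (by simpa using hs)
  have := Real.pi_lt_d2
  nlinarith [Real.pi_pos]

theorem norm_riemannZeta_le_two {s : ℂ} (hs : 2 ≤ s.re) : ‖riemannZeta s‖ ≤ 2 := by
  have h := norm_riemannZeta_sub_one_le hs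
  have := norm_sub_norm_le (riemannZeta s) 1
  rw [norm_one] at this
  linarith

theorem one_fourth_le_norm_riemannZeta {s : ℂ} (hs : 2 ≤ s.re) : 1 / 4 ≤ ‖riemannZeta s‖ := by
  have h := norm_riemannZeta_sub_one_le hs
  have := norm_sub_norm_le 1 (riemannZeta s)
  rw [norm_one, norm_sub_rev] at this
  linarith

/-- The fractional part of `t`, cut off to `t > 1`; its Mellin transform at `-s` is
`∫ t in (1, ∞), {t} t ^ (-s - 1)`. -/
noncomputable def fractTail : ℝ → ℂ :=
  Set.indicator (Set.Ioi 1) (fun t : ℝ => ((Int.fract t : ℝ) : ℂ))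

theorem norm_fractTail_le (t : ℝ) : ‖fractTail t‖ ≤ 1 := by
  rw [fractTail, Set.indicator_apply]
  split_ifs
  · rw [Complex.norm_real, Real.norm_of_nonneg (Int.fract_nonneg t)]
    exact (Int.fract_lt_one t).le
  · simp

theorem locallyIntegrableOn_fractTail :
    MeasureTheory.LocallyIntegrableOn fractTail (Set.Ioi 0) := by
  have hm : Measurable fractTail :=
    (Complex.measurable_ofReal.comp measurable_fract).indicator measurableSet_Ioi
  refine ((MeasureTheory.locallyIntegrable_const (1 : ℝ)).mono hm.aestronglyMeasurable
    (Eventually.of_forall fun t => ?_)).locallyIntegrableOn _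
  simpa using norm_fractTail_le t

theorem isBigO_atTop_fractTail : fractTail =O[atTop] fun t : ℝ => t ^ (-(0:ℝ)) :=
  Asymptotics.IsBigO.of_bound 1 (Eventually.of_forall fun t => by simpa using norm_fractTail_le t)

theorem isBigO_zero_fractTail (b : ℝ) : fractTail =O[𝓝[>] 0] fun t : ℝ => t ^ (-b) := by
  refine (Asymptotics.isBigO_zero _ _).congr' ?_ EventuallyEq.rfl
  filter_upwards [mem_nhdsWithin_of_mem_nhds (Iio_mem_nhds one_pos)] with t ht
  have : t ∉ Set.Ioi (1:ℝ) := Set.notMem_Ioi.mpr (Set.mem_Iio.mp ht).le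
  simp [fractTail, this]

theorem differentiableAt_mellin_fractTail {s : ℂ} (hs : s.re < 0) :
    DifferentiableAt ℂ (mellin fractTail) s :=
  mellin_differentiableAt_of_isBigO_rpow (b := s.re - 1) locallyIntegrableOn_fractTail
    isBigO_atTop_fractTail hs (isBigO_zero_fractTail _) (by linarith)

theorem mellinConvergent_fractTail {s : ℂ} (hs : s.re < 0) : MellinConvergent fractTail s :=
  mellinConvergent_of_isBigO_rpow (b := s.re - 1) locallyIntegrableOn_fractTail
    isBigO_atTop_fractTail hs (isBigO_zero_fractTail _) (by linarith)

theorem smul_fractTail_eq (s : ℂ) :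
    (fun t : ℝ => (t : ℂ) ^ (s - 1) • fractTail t) =
      Set.indicator (Set.Ioi 1) (fun t : ℝ => (t : ℂ) ^ (s - 1) * ((Int.fract t : ℝ) : ℂ)) := by
  ext t
  simp only [fractTail, Set.indicator_apply]
  split_ifs <;> simp

theorem mellin_fractTail (s : ℂ) :
    mellin fractTail s = ∫ t in Set.Ioi (1 : ℝ), (t : ℂ) ^ (s - 1) * ((Int.fract t : ℝ) : ℂ) := by
  rw [mellin, smul_fractTail_eq, MeasureTheory.setIntegral_indicator measurableSet_Ioi,
    Set.inter_eq_self_of_subset_right (Set.Ioi_subset_Ioi zero_le_one)]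

theorem integrableOn_cpow_mul_fract {s : ℂ} (hs : s.re < 0) :
    MeasureTheory.IntegrableOn (fun t : ℝ => (t : ℂ) ^ (s - 1) * ((Int.fract t : ℝ) : ℂ))
      (Set.Ioi 1) := by
  have h := mellinConvergent_fractTail hs
  rw [MellinConvergent, smul_fractTail_eq,
    MeasureTheory.integrableOn_indicator_iff measurableSet_Ioi,
    Set.inter_eq_self_of_subset_left (Set.Ioi_subset_Ioi zero_le_one)] at h
  exact h

/-- Abel summation: `ζ(s) = s ∫ ⌊t⌋ t ^ (-s - 1) dt` over `(1, ∞)`, with `⌊t⌋ = t - {t}`. -/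
theorem riemannZeta₁_eq_of_one_lt {s : ℂ} (hs : 1 < s.re) :
    riemannZeta₁ s = s - s * (s - 1) * mellin fractTail (-s) := by
  have hs1 : s ≠ 1 := by rintro rfl; simp at hs
  have hs1' : s - 1 ≠ 0 := sub_ne_zero.mpr hs1
  have h1 : riemannZeta s = s * ∫ t in Set.Ioi (1 : ℝ),
      (∑ k ∈ Finset.Icc 1 ⌊t⌋₊, ((1 : ℝ) : ℂ)) * (t : ℂ) ^ (-(s + 1)) := by
    rw [← LSeries_eq_mul_integral_of_nonneg (fun _ => (1 : ℝ)) zero_le_one hs ?_ (by simp),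
      ← LSeries_one_eq_riemannZeta hs]
    · congr 1
    · simpa using Asymptotics.isBigO_refl _ _
  have hI : ∫ t in Set.Ioi (1 : ℝ), (t : ℂ) ^ (-s) = 1 / (s - 1) := by
    rw [integral_Ioi_cpow_of_lt (by simpa using hs) one_pos]
    have : -s + 1 ≠ 0 := fun h => hs1' (by linear_combination -h)
    rw [Complex.ofReal_one, Complex.one_cpow]
    field_simp
    ring
  have h2 : ∫ t in Set.Ioi (1 : ℝ),
      (∑ k ∈ Finset.Icc 1 ⌊t⌋₊, ((1 : ℝ) : ℂ)) * (t : ℂ) ^ (-(s + 1)) =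
      1 / (s - 1) - mellin fractTail (-s) := by
    rw [mellin_fractTail, ← hI, ← MeasureTheory.integral_sub
      (integrableOn_Ioi_cpow_of_lt (a := -s) (by simpa using hs) one_pos)
      (integrableOn_cpow_mul_fract (s := -s) (by simp only [Complex.neg_re]; linarith))]
    refine MeasureTheory.setIntegral_congr_fun measurableSet_Ioi fun t ht => ?_
    have ht0 : (0 : ℝ) < t := one_pos.trans ht
    have ht' : (t : ℂ) ≠ 0 := Complex.ofReal_ne_zero.mpr ht0.ne'
    have e1 : (t : ℂ) ^ (-s) = t * (t : ℂ) ^ (-(s + 1)) := by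
      rw [show -s = 1 + -(s + 1) by ring, Complex.cpow_add _ _ ht', Complex.cpow_one]
    have e2 : ((⌊t⌋₊ : ℕ) : ℂ) = (t : ℂ) - ((Int.fract t : ℝ) : ℂ) := by
      have : ((⌊t⌋₊ : ℕ) : ℝ) = t - Int.fract t := by
        rw [natCast_floor_eq_intCast_floor ht0.le, Int.self_sub_fract]
      exact_mod_cast this
    simp only [Complex.ofReal_one, Finset.sum_const, Nat.card_Icc, Nat.add_sub_cancel,
      nsmul_eq_mul, mul_one]
    rw [e2, e1, show -s - 1 = -(s + 1) by ring]
    ring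
  have h3 : riemannZeta₁ s = (s - 1) * riemannZeta s := by
    rw [riemannZeta_eq_inv_sub_mul hs1, mul_inv_cancel_left₀ hs1']
  rw [h3, h1, h2]
  field_simp

/-- The formula of `riemannZeta₁_eq_of_one_lt` continued to the half-plane `0 < re s`. -/
theorem riemannZeta₁_eq_of_pos {s : ℂ} (hs : 0 < s.re) :
    riemannZeta₁ s = s - s * (s - 1) * mellin fractTail (-s) := by
  have hU : IsOpen {s : ℂ | 0 < s.re} := isOpen_lt continuous_const Complex.continuous_re
  have hd : DifferentiableOn ℂ (fun s : ℂ => s - s * (s - 1) * mellin fractTail (-s))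
      {s : ℂ | 0 < s.re} := by
    intro s hs
    have : DifferentiableAt ℂ (fun s : ℂ => mellin fractTail (-s)) s :=
      (differentiableAt_mellin_fractTail (s := -s)
        (by simpa using hs)).comp s differentiableAt_id.neg
    exact DifferentiableAt.differentiableWithinAt (by fun_prop)
  refine AnalyticOnNhd.eqOn_of_preconnected_of_eventuallyEq (𝕜 := ℂ) (z₀ := 2)
    ((differentiable_riemannZeta₁.differentiableOn).analyticOnNhd hU) (hd.analyticOnNhd hU)
    (convex_halfSpace_re_gt 0).isPreconnected (by simp) ?_ hs
  filter_upwards [(isOpen_lt continuous_const Complex.continuous_re).mem_nhds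
    (show (1 : ℝ) < (2 : ℂ).re by simp)] with w hw
  exact riemannZeta₁_eq_of_one_lt hw

/-- On `(0, 1)` the value `(σ - 1) ζ(σ) = σ + σ (1 - σ) ∫ {t} t ^ (-σ - 1) dt` is positive. -/
theorem riemannZeta_ofReal_ne_zero {σ : ℝ} (h0 : 0 < σ) (h1 : σ < 1) : riemannZeta σ ≠ 0 := by
  have hJ : mellin fractTail (-σ) =
      ((∫ t in Set.Ioi (1 : ℝ), t ^ (-σ - 1) * Int.fract t : ℝ) : ℂ) := by
    rw [mellin_fractTail, ← integral_complex_ofReal]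
    refine MeasureTheory.setIntegral_congr_fun measurableSet_Ioi fun t ht => ?_
    have ht0 : (0 : ℝ) ≤ t := (one_pos.trans ht).le
    push_cast [Complex.ofReal_cpow ht0]
    rfl
  have hJ0 : 0 ≤ ∫ t in Set.Ioi (1 : ℝ), t ^ (-σ - 1) * Int.fract t :=
    MeasureTheory.setIntegral_nonneg measurableSet_Ioi fun t ht =>
      mul_nonneg (Real.rpow_nonneg (one_pos.trans ht).le _) (Int.fract_nonneg t)
  have hne : (σ : ℂ) ≠ 1 := by exact_mod_cast h1.ne
  rw [riemannZeta_eq_inv_sub_mul hne, riemannZeta₁_eq_of_pos (by simpa), hJ]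
  refine mul_ne_zero (inv_ne_zero (sub_ne_zero.mpr hne)) ?_
  have hpos : 0 < σ + σ * (1 - σ) * ∫ t in Set.Ioi (1 : ℝ), t ^ (-σ - 1) * Int.fract t := by
    have := mul_nonneg (mul_nonneg h0.le (sub_nonneg.mpr h1.le)) hJ0
    linarith
  intro h
  apply hpos.ne'
  have h' : (((σ + σ * (1 - σ) * ∫ t in Set.Ioi (1 : ℝ), t ^ (-σ - 1) * Int.fract t) : ℝ) : ℂ)
      = 0 := by
    push_cast
    rw [← h]
    ring
  exact_mod_cast h'

/-! ### Zeros, symmetry and growth of the xi function -/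

theorem riemannXi_one_sub (s : ℂ) : riemannXi (1 - s) = riemannXi s := by
  rw [riemannXi_eq, riemannXi_eq, completedRiemannZeta₀_one_sub]
  ring

theorem riemannXi_one : riemannXi 1 = 1 / 2 := by
  rw [riemannXi_eq]
  ring

theorem riemannXi_eq_of_re_pos {s : ℂ} (hs : 0 < s.re) (h1 : s ≠ 1) :
    riemannXi s = 1 / 2 * s * (s - 1) * (Real.pi : ℂ) ^ (-(1 / 2) * s) *
      Complex.Gamma (1 / 2 * s) * riemannZeta s := by
  rw [riemannXi_eq_product h1 fun n hn => ?_, riemannXiProduct]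
  have := congrArg Complex.re hn
  simp only [Complex.neg_re, Complex.mul_re, Complex.re_ofNat, Complex.natCast_re,
    Complex.im_ofNat, zero_mul, sub_zero] at this
  have : (0 : ℝ) ≤ n := n.cast_nonneg
  linarith

theorem riemannXi_eq_zero_of_riemannZeta_eq_zero {s : ℂ} (hz : riemannZeta s = 0)
    (ht : ∀ n : ℕ, s ≠ -2 * (n + 1)) : riemannXi s = 0 := by
  have h1 : s ≠ 1 := by
    rintro rfl
    exact riemannZeta_one_ne_zero hz
  rw [riemannXi_eq_product h1 fun n hn => ?_, riemannXiProduct, hz, mul_zero]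
  rcases n with _ | n
  · rw [hn] at hz
    norm_num [riemannZeta_zero] at hz
  · exact ht n (by rw [hn]; push_cast; ring)

theorem riemannXi_ne_zero {s : ℂ} (hs : 0 < s.re) (hz : s ≠ 1 → riemannZeta s ≠ 0) :
    riemannXi s ≠ 0 := by
  rcases eq_or_ne s 1 with rfl | h1
  · rw [riemannXi_one]
    norm_num
  have h0 : s ≠ 0 := by
    rintro rfl
    simp at hs
  rw [riemannXi_eq_of_re_pos hs h1]
  have hG : Complex.Gamma (1 / 2 * s) ≠ 0 := Complex.Gamma_ne_zero_of_re_pos (by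
    simpa using hs)
  have hpi : (Real.pi : ℂ) ^ (-(1 / 2) * s) ≠ 0 := by
    simp [Complex.cpow_eq_zero_iff, Real.pi_ne_zero]
  exact mul_ne_zero (mul_ne_zero (mul_ne_zero (mul_ne_zero (mul_ne_zero (by norm_num) h0)
    (sub_ne_zero.mpr h1)) hpi) hG) (hz h1)

theorem riemannXi_ne_zero_of_one_half_le {σ : ℝ} (hσ : 1 / 2 ≤ σ) : riemannXi σ ≠ 0 := by
  refine riemannXi_ne_zero (by simp; linarith) fun _ => ?_
  rcases lt_or_ge σ 1 with h | h
  · exact riemannZeta_ofReal_ne_zero (by linarith) h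
  · exact riemannZeta_ne_zero_of_one_le_re (by simpa)

/-- `ξ` has no real zeros; this is what makes the two forms of the Riemann Hypothesis agree. -/
theorem riemannXi_ofReal_ne_zero (σ : ℝ) : riemannXi σ ≠ 0 := by
  rcases le_total (1 / 2) σ with h | h
  · exact riemannXi_ne_zero_of_one_half_le h
  · rw [← riemannXi_one_sub]
    exact_mod_cast riemannXi_ne_zero_of_one_half_le (σ := 1 - σ) (by linarith)

theorem norm_riemannXi {s : ℂ} (hs : 0 < s.re) (h1 : s ≠ 1) :
    ‖riemannXi s‖ = 1 / 2 * ‖s‖ * ‖s - 1‖ * Real.pi ^ (-(s.re / 2)) *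
      ‖Complex.Gamma (1 / 2 * s)‖ * ‖riemannZeta s‖ := by
  rw [riemannXi_eq_of_re_pos hs h1]
  simp only [norm_mul]
  rw [Complex.norm_cpow_eq_rpow_re_of_pos Real.pi_pos]
  have : (-(1 / 2) * s).re = -(s.re / 2) := by simp; ring
  rw [this]
  norm_num

open ComplexConjugate in
theorem norm_riemannXi_conj {s : ℂ} (hs : 0 < s.re) : ‖riemannXi (conj s)‖ = ‖riemannXi s‖ := by
  rcases eq_or_ne s 1 with rfl | h1
  · rw [map_one]
  have h1' : conj s ≠ 1 := fun h => h1 (by simpa using congrArg conj h)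
  have e1 : conj s - 1 = conj (s - 1) := by simp
  have e2 : 1 / 2 * conj s = conj (1 / 2 * s) := by
    rw [map_mul, map_div₀, map_one, map_ofNat]
  rw [norm_riemannXi (by simpa) h1', norm_riemannXi hs h1, riemannZeta_conj, e1, e2,
    Complex.Gamma_conj]
  simp only [Complex.norm_conj, Complex.conj_re]

/-- If a Mellin transform converges everywhere, it is bounded on every closed vertical strip. -/
theorem norm_mellin_le {f : ℝ → ℂ} (hf : ∀ s : ℂ, MellinConvergent f s) (a b : ℝ) :
    ∃ C, ∀ s : ℂ, a ≤ s.re → s.re ≤ b → ‖mellin f s‖ ≤ C := by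
  have hn : ∀ (s : ℂ), ∀ t ∈ Set.Ioi (0 : ℝ), ‖(t : ℂ) ^ (s - 1) • f t‖ =
      t ^ (s.re - 1) * ‖f t‖ := by
    intro s t ht
    rw [norm_smul, Complex.norm_cpow_eq_rpow_re_of_pos ht, Complex.sub_re, Complex.one_re]
  have hi : ∀ x : ℝ, MeasureTheory.IntegrableOn (fun t : ℝ => t ^ (x - 1) * ‖f t‖)
      (Set.Ioi 0) := fun x =>
    MeasureTheory.IntegrableOn.congr_fun (hf x).norm
      (fun t ht => by simpa only [Complex.ofReal_re] using hn x t ht) measurableSet_Ioi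
  refine ⟨∫ t in Set.Ioi (0 : ℝ), (t ^ (a - 1) * ‖f t‖ + t ^ (b - 1) * ‖f t‖), fun s ha hb => ?_⟩
  refine MeasureTheory.norm_integral_le_of_norm_le ((hi a).add (hi b))
    ((MeasureTheory.ae_restrict_mem measurableSet_Ioi).mono fun t ht => ?_)
  have ht0 : (0 : ℝ) < t := ht
  rw [hn s t ht, ← add_mul]
  refine mul_le_mul_of_nonneg_right ?_ (norm_nonneg _)
  rcases le_total t 1 with h | h
  · have := Real.rpow_le_rpow_of_exponent_ge ht0 h (show a - 1 ≤ s.re - 1 by linarith)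
    linarith [Real.rpow_pos_of_pos ht0 (b - 1)]
  · have := Real.rpow_le_rpow_of_exponent_le h (show s.re - 1 ≤ b - 1 by linarith)
    linarith [Real.rpow_pos_of_pos ht0 (a - 1)]

/-- Polynomial growth of `ξ` in vertical strips: `completedRiemannZeta₀` is a Mellin transform that
converges everywhere. -/
theorem norm_riemannXi_le (a b : ℝ) :
    ∃ C, 0 < C ∧ ∀ s : ℂ, a ≤ s.re → s.re ≤ b → ‖riemannXi s‖ ≤ C * (1 + ‖s‖) ^ 2 := by
  obtain ⟨C, hC⟩ := norm_mellin_le (f := (HurwitzZeta.hurwitzEvenFEPair 0).f_modif)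
    (fun s => ((HurwitzZeta.hurwitzEvenFEPair 0).isStrongFEPair_toStrongFEPair.hasMellin s).1)
    (a / 2) (b / 2)
  refine ⟨|C| + 1, by positivity, fun s ha hb => ?_⟩
  have h : ‖completedRiemannZeta₀ s‖ ≤ |C| := by
    have h1 := hC (s / 2) (by simp; linarith) (by simp; linarith)
    have h2 : completedRiemannZeta₀ s =
      mellin (HurwitzZeta.hurwitzEvenFEPair 0).f_modif (s / 2) / 2 := rfl
    rw [h2, norm_div, Complex.norm_ofNat]
    linarith [le_abs_self C, norm_nonneg (mellin (HurwitzZeta.hurwitzEvenFEPair 0).f_modif (s / 2))]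
  have h1 : ‖s - 1‖ ≤ ‖s‖ + 1 := by simpa using norm_sub_le s 1
  have h2 : ‖s * (s - 1) * completedRiemannZeta₀ s + 1‖ ≤ ‖s‖ * (‖s‖ + 1) * |C| + 1 := by
    refine (norm_add_le _ _).trans ?_
    rw [norm_mul, norm_mul, norm_one]
    gcongr
  rw [riemannXi_eq, norm_div, Complex.norm_ofNat]
  have := norm_nonneg s
  have := abs_nonneg C
  have : 0 ≤ ‖s‖ * |C| := by positivity
  nlinarith

/-- On a vertical line right of `re s = 2`, `|ξ|` decays at most exponentially. -/
theorem exp_neg_le_norm_riemannXi {b : ℝ} (hb : 2 < b) :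
    ∃ c, 0 < c ∧ ∀ s : ℂ, s.re = b → c * Real.exp (-(Real.pi / 2 * |s.im|)) ≤ ‖riemannXi s‖ := by
  have hk : 0 < b / 2 - 1 := by linarith
  have hG := Real.Gamma_pos_of_pos (show 0 < 1 + (b / 2 - 1) by linarith)
  have hpi := Real.rpow_pos_of_pos Real.pi_pos (-(b / 2))
  refine ⟨1 / 2 * 1 * 1 * Real.pi ^ (-(b / 2)) * Real.Gamma (1 + (b / 2 - 1)) * (1 / 4),
    by positivity, fun s hs => ?_⟩
  have h1 : s ≠ 1 := by
    rintro rfl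
    rw [Complex.one_re] at hs
    linarith
  have e : (1 / 2 * s : ℂ) = (1 + ((s.im / 2 : ℝ) : ℂ) * Complex.I) + ((b / 2 - 1 : ℝ) : ℂ) := by
    apply Complex.ext
    · simp; linarith
    · simp; ring
  have hΓ := Complex.norm_Gamma_mul_le (z := 1 + ((s.im / 2 : ℝ) : ℂ) * Complex.I) one_pos
    (by simp) hk
  rw [Real.Gamma_one, one_mul, ← e] at hΓ
  have hΓ' := Complex.exp_neg_le_norm_Gamma_one_add (s.im / 2)
  rw [abs_div, abs_two, show Real.pi * (|s.im| / 2) = Real.pi / 2 * |s.im| by ring] at hΓ'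
  have hΓ'' : Real.Gamma (1 + (b / 2 - 1)) * Real.exp (-(Real.pi / 2 * |s.im|)) ≤
      ‖Complex.Gamma (1 / 2 * s)‖ := by
    refine le_trans ?_ hΓ
    rw [mul_comm]
    gcongr
  have hs1 : 1 ≤ ‖s‖ := by
    have := Complex.re_le_norm s
    linarith
  have hs2 : 1 ≤ ‖s - 1‖ := by
    have := Complex.re_le_norm (s - 1)
    rw [Complex.sub_re, Complex.one_re] at this
    linarith
  have hζ := one_fourth_le_norm_riemannZeta (s := s) (by linarith)
  rw [norm_riemannXi (by linarith) h1, hs]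
  calc _ = 1 / 2 * 1 * 1 * Real.pi ^ (-(b / 2)) *
        (Real.Gamma (1 + (b / 2 - 1)) * Real.exp (-(Real.pi / 2 * |s.im|))) * (1 / 4) := by ring
    _ ≤ _ := by gcongr

/-! ### Lower bounds for the xi function in a zero-free half-plane -/

/-- A zero-free holomorphic function on a disc has a holomorphic logarithm, normalised to vanish at
the centre after division by the central value. -/
theorem DifferentiableOn.exists_eq_mul_exp {f : ℂ → ℂ} {w : ℂ} {R : ℝ} (hR : 0 < R)
    (hf : DifferentiableOn ℂ f (Metric.ball w R)) (h0 : ∀ z ∈ Metric.ball w R, f z ≠ 0) :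
    ∃ F : ℂ → ℂ, F w = 0 ∧ DifferentiableOn ℂ F (Metric.ball w R) ∧
      ∀ z ∈ Metric.ball w R, f z = f w * Complex.exp (F z) := by
  have hd : DifferentiableOn ℂ (_root_.deriv f / f) (Metric.ball w R) :=
    (hf.deriv Metric.isOpen_ball).div hf h0
  obtain ⟨F, hFw, hF⟩ := hd.isExactOn_ball.with_val_at w 0
  refine ⟨F, hFw, fun z hz => (hF z hz).differentiableAt.differentiableWithinAt, fun z hz => ?_⟩
  have hconst : ∀ z ∈ Metric.ball w R,
      HasDerivAt (fun z => f z * Complex.exp (-F z)) 0 z := by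
    intro z hz
    have h1 := (hf.differentiableAt (Metric.isOpen_ball.mem_nhds hz)).hasDerivAt
    have hz0 := h0 z hz
    refine (h1.mul (hF z hz).neg.cexp).congr_deriv ?_
    rw [Pi.div_apply]
    field_simp
    ring
  have := Metric.isOpen_ball.is_const_of_deriv_eq_zero (𝕜 := ℂ) (convex_ball w R).isPreconnected
    (fun z hz => (hconst z hz).differentiableAt.differentiableWithinAt)
    (fun z hz => (hconst z hz).deriv) hz (Metric.mem_ball_self hR)
  rw [hFw, neg_zero, Complex.exp_zero, mul_one] at this
  rw [← this, mul_assoc, ← Complex.exp_add, neg_add_cancel, Complex.exp_zero, mul_one]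

/-- Minimum modulus bound for a zero-free holomorphic function on a disc: the Borel–Carathéodory
theorem applied to `log (f / f w)`. -/
theorem exp_neg_mul_le_norm_of_ne_zero {f : ℂ → ℂ} {w z : ℂ} {R r M : ℝ} (hr : 0 ≤ r) (hrR : r < R)
    (hM : 0 < M) (hf : DifferentiableOn ℂ f (Metric.ball w R))
    (h0 : ∀ z ∈ Metric.ball w R, f z ≠ 0)
    (hb : ∀ z ∈ Metric.ball w R, ‖f z‖ ≤ Real.exp M * ‖f w‖) (hz : ‖z - w‖ ≤ r) :
    Real.exp (-(2 * M * r / (R - r))) * ‖f w‖ ≤ ‖f z‖ := by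
  have hR : 0 < R := hr.trans_lt hrR
  obtain ⟨F, hFw, hF, hfF⟩ := hf.exists_eq_mul_exp hR h0
  have hw0 : 0 < ‖f w‖ := norm_pos_iff.mpr (h0 w (Metric.mem_ball_self hR))
  have hmaps : Set.MapsTo (fun u => w + u) (Metric.ball 0 R) (Metric.ball w R) := by
    intro u hu
    simpa using hu
  have hre : Set.MapsTo (fun u => F (w + u)) (Metric.ball 0 R) {z | z.re ≤ M} := by
    intro u hu
    have h := hb _ (hmaps hu)
    rw [hfF _ (hmaps hu), norm_mul, Complex.norm_exp, mul_comm] at h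
    exact Real.exp_le_exp.mp (le_of_mul_le_mul_right h hw0)
  have hzb : z - w ∈ Metric.ball (0 : ℂ) R := by
    rw [mem_ball_zero_iff]
    linarith
  have hBC := Complex.borelCaratheodory_zero hM (f := fun u => F (w + u))
    (hF.comp (by fun_prop) hmaps) hre hR hzb (by simpa using hFw)
  have hle : 2 * M * ‖z - w‖ / (R - ‖z - w‖) ≤ 2 * M * r / (R - r) := by
    have : 0 < R - r := by linarith
    gcongr
  have hzw : w + (z - w) = z := by ring
  have hzR := hmaps hzb
  simp only [hzw] at hBC hzR
  rw [hfF z hzR, norm_mul, Complex.norm_exp, mul_comm]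
  have := (abs_le.mp ((Complex.abs_re_le_norm (F z)).trans (hBC.trans hle))).1
  gcongr

/-- If `ξ` has no zeros right of the critical line, then `1 / ξ` is of at most exponential growth in
every closed strip right of that line. The bound at `s` uses the disc that has its centre on
`re = b` at the height of `s` and touches the critical line. -/
theorem exists_exp_neg_le_norm_riemannXi (h0 : ∀ s : ℂ, 1 / 2 < s.re → riemannXi s ≠ 0) {a b : ℝ}
    (ha : 1 / 2 < a) (hab : a ≤ b) (hb : 2 < b) :
    ∃ A, 0 < A ∧ ∀ s : ℂ, a ≤ s.re → s.re ≤ b →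
      Real.exp (-(A * (1 + |s.im|))) ≤ ‖riemannXi s‖ := by
  obtain ⟨C, hC, hCle⟩ := norm_riemannXi_le (1 / 2) (2 * b)
  obtain ⟨c, hc, hcle⟩ := exp_neg_le_norm_riemannXi hb
  -- `K * (1 + |im s|)` bounds `log |ξ / ξ w|` on the disc of radius `b - 1 / 2` about `w`.
  set K := |Real.log (C / c)| + 2 * (3 * b + 1) + Real.pi / 2 + 2 with hK
  have hKpos : 0 < K := by positivity
  set q := (b - a) / (a - 1 / 2) with hq
  have hq0 : 0 ≤ q := div_nonneg (by linarith) (by linarith)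
  refine ⟨2 * K * q + |Real.log c| + Real.pi / 2, by positivity, fun s hs1 hs2 => ?_⟩
  set w : ℂ := b + s.im * Complex.I with hw
  have hwre : w.re = b := by simp [hw]
  have hwim : w.im = s.im := by simp [hw]
  have hlow := hcle w hwre
  rw [hwim] at hlow
  have hM : 0 < K * (1 + |s.im|) := by positivity
  have hzw : ‖s - w‖ ≤ b - a := by
    have : s - w = ((s.re - b : ℝ) : ℂ) := by
      apply Complex.ext <;> simp [hwre, hwim]
    rw [this, Complex.norm_real, Real.norm_eq_abs, abs_le]
    constructor <;> linarith
  have hball : ∀ z ∈ Metric.ball w (b - 1 / 2), 1 / 2 < z.re ∧ z.re ≤ 2 * b ∧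
      ‖z‖ ≤ 3 * b + |s.im| := by
    intro z hz
    rw [mem_ball_iff_norm] at hz
    have h1 := abs_le.mp ((Complex.abs_re_le_norm (z - w)).trans hz.le)
    have h1' := abs_lt.mp ((Complex.abs_re_le_norm (z - w)).trans_lt hz)
    rw [Complex.sub_re, hwre] at h1 h1'
    have h2 : ‖w‖ ≤ b + |s.im| := by
      have := Complex.norm_le_abs_re_add_abs_im w
      rwa [hwre, hwim, abs_of_pos (by linarith)] at this
    have h3 : ‖z‖ ≤ ‖z - w‖ + ‖w‖ := by simpa using norm_add_le (z - w) w
    exact ⟨by linarith, by linarith, by linarith⟩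
  have hup : ∀ z ∈ Metric.ball w (b - 1 / 2),
      ‖riemannXi z‖ ≤ Real.exp (K * (1 + |s.im|)) * ‖riemannXi w‖ := by
    intro z hz
    obtain ⟨hz1, hz2, hz3⟩ := hball z hz
    have e1 : (1 + ‖z‖) ^ 2 ≤ Real.exp (2 * (3 * b + |s.im|)) := by
      have : 1 + ‖z‖ ≤ Real.exp (3 * b + |s.im|) := by
        linarith [Real.add_one_le_exp (3 * b + |s.im|)]
      calc (1 + ‖z‖) ^ 2 ≤ Real.exp (3 * b + |s.im|) ^ 2 := by gcongr
        _ = _ := by rw [← Real.exp_nat_mul]; norm_num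
    have e2 : C ≤ c * Real.exp |Real.log (C / c)| := by
      have : C / c ≤ Real.exp |Real.log (C / c)| := by
        rw [← Real.log_le_iff_le_exp (div_pos hC hc)]
        exact le_abs_self _
      rwa [div_le_iff₀' hc] at this
    calc ‖riemannXi z‖ ≤ C * (1 + ‖z‖) ^ 2 := hCle z hz1.le hz2
      _ ≤ (c * Real.exp |Real.log (C / c)|) * Real.exp (2 * (3 * b + |s.im|)) := by gcongr
      _ = Real.exp (|Real.log (C / c)| + 2 * (3 * b + |s.im|) + Real.pi / 2 * |s.im|) *
          (c * Real.exp (-(Real.pi / 2 * |s.im|))) := by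
        rw [Real.exp_neg, Real.exp_add, Real.exp_add]
        field_simp
      _ ≤ Real.exp (K * (1 + |s.im|)) * ‖riemannXi w‖ := by
        gcongr
        rw [hK]
        have p1 : 0 ≤ |Real.log (C / c)| * |s.im| := by positivity
        have p2 : 0 ≤ b * |s.im| := mul_nonneg (by linarith) (abs_nonneg _)
        nlinarith [Real.pi_pos, abs_nonneg s.im, abs_nonneg (Real.log (C / c))]
  have h := exp_neg_mul_le_norm_of_ne_zero (r := b - a) (by linarith) (by linarith) hM
    differentiable_riemannXi.differentiableOn (fun z hz => h0 z (hball z hz).1) hup hzw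
  have e3 : 2 * (K * (1 + |s.im|)) * (b - a) / (b - 1 / 2 - (b - a)) =
      2 * K * q * (1 + |s.im|) := by
    rw [hq, show b - 1 / 2 - (b - a) = a - 1 / 2 by ring]
    ring
  rw [e3] at h
  have e4 : Real.exp (-|Real.log c|) ≤ c := by
    rw [← Real.le_log_iff_exp_le hc]
    exact neg_abs_le _
  calc _ ≤ Real.exp (-(2 * K * q * (1 + |s.im|))) *
        (Real.exp (-|Real.log c|) * Real.exp (-(Real.pi / 2 * |s.im|))) := by
        rw [← Real.exp_add, ← Real.exp_add]
        gcongr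
        nlinarith [Real.pi_pos, mul_nonneg (abs_nonneg (Real.log c)) (abs_nonneg s.im)]
    _ ≤ Real.exp (-(2 * K * q * (1 + |s.im|))) * ‖riemannXi w‖ := by
        gcongr
        refine le_trans ?_ hlow
        gcongr
    _ ≤ _ := h

/-! ### Comparison of the xi function with its horizontal translates -/

/-- Bound for `ξ(s - h) / ξ(s)` in the half-plane where both zeta values are controlled by
the Dirichlet series; the Gamma factors are compared by `Complex.norm_Gamma_mul_le`. -/
theorem norm_riemannXi_sub_div_le {h x : ℝ} (hh : 0 < h) (hx : 1 ≤ x) {s : ℂ}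
    (hs : 2 * x + h ≤ s.re) :
    ‖riemannXi (s - h) / riemannXi s‖ ≤
      8 * Real.pi ^ (h / 2) * (Real.Gamma x / Real.Gamma (x + h / 2)) := by
  have h1 : s ≠ 1 := by
    rintro rfl
    rw [Complex.one_re] at hs
    linarith
  have hre : (s - h).re = s.re - h := by simp
  have h1' : s - h ≠ 1 := fun e => by
    rw [e, Complex.one_re] at hre
    linarith
  have hξ : riemannXi s ≠ 0 := riemannXi_ne_zero (by linarith)
    fun _ => riemannZeta_ne_zero_of_one_le_re (by linarith)
  have hmono : ∀ u : ℂ, h ≤ u.re → ‖u - h‖ ≤ ‖u‖ := by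
    intro u hu
    rw [← sq_le_sq₀ (norm_nonneg _) (norm_nonneg _), Complex.sq_norm, Complex.sq_norm,
      Complex.normSq_apply, Complex.normSq_apply]
    simp only [Complex.sub_re, Complex.ofReal_re, Complex.sub_im, Complex.ofReal_im, sub_zero]
    nlinarith
  have a1 := hmono s (by linarith)
  have a2 := hmono (s - 1) (by simp; linarith)
  rw [sub_right_comm] at a2
  have b1 := norm_riemannZeta_le_two (s := s - h) (by rw [hre]; linarith)
  have b2 := one_fourth_le_norm_riemannZeta (s := s) (by linarith)
  have hGx := Real.Gamma_pos_of_pos (show 0 < x by linarith)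
  have hGxh := Real.Gamma_pos_of_pos (show 0 < x + h / 2 by linarith)
  have c1 := Complex.norm_Gamma_mul_le (z := 1 / 2 * (s - h)) (x := x) (k := h / 2) (by linarith)
    (by
      have : (1 / 2 * (s - h) : ℂ).re = 1 / 2 * (s.re - h) := by simp
      rw [this]
      linarith) (by linarith)
  rw [show (1 / 2 * (s - h) + ((h / 2 : ℝ) : ℂ)) = 1 / 2 * s by push_cast; ring,
    ← le_div_iff₀ hGxh] at c1
  have d1 : Real.pi ^ (-((s - h).re / 2)) = Real.pi ^ (h / 2) * Real.pi ^ (-(s.re / 2)) := by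
    rw [← Real.rpow_add Real.pi_pos, hre]
    congr 1
    ring
  have p1 := Real.rpow_pos_of_pos Real.pi_pos (h / 2)
  have p2 := Real.rpow_pos_of_pos Real.pi_pos (-(s.re / 2))
  rw [norm_div, div_le_iff₀ (norm_pos_iff.mpr hξ), norm_riemannXi (by linarith) h1,
    norm_riemannXi (by linarith) h1', d1]
  calc _ ≤ 1 / 2 * ‖s‖ * ‖s - 1‖ * (Real.pi ^ (h / 2) * Real.pi ^ (-(s.re / 2))) *
        (Real.Gamma x * ‖Complex.Gamma (1 / 2 * s)‖ / Real.Gamma (x + h / 2)) *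
        (8 * ‖riemannZeta s‖) := by
        gcongr
        linarith
    _ = _ := by ring

theorem tendsto_riemannXi_sub_div {h c : ℝ} (hh : 0 < h) :
    Tendsto (fun x : ℝ => riemannXi ((x : ℂ) + c - h) / riemannXi ((x : ℂ) + c)) atTop (𝓝 0) := by
  have hx : Tendsto (fun x : ℝ => (x + c - h) / 2) atTop atTop := by
    refine Tendsto.atTop_div_const two_pos ?_
    simp only [add_sub_assoc]
    exact tendsto_atTop_add_const_right _ _ tendsto_id
  have hlim := ((Real.tendsto_Gamma_div_Gamma_add (half_pos hh)).comp hx).const_mul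
    (8 * Real.pi ^ (h / 2))
  rw [mul_zero] at hlim
  refine squeeze_zero_norm' ?_ hlim
  filter_upwards [eventually_ge_atTop (2 + h - c)] with x hx
  exact norm_riemannXi_sub_div_le hh (by linarith) (by simp; linarith)

/-- On the line `re s = 1 / 2 + h / 2`, the points `s` and `s - h` are mirror images in the critical
line. -/
theorem norm_riemannXi_sub_eq {h : ℝ} {s : ℂ} (hh : 0 < h) (hs : s.re = 1 / 2 + h / 2) :
    ‖riemannXi (s - h)‖ = ‖riemannXi s‖ := by
  rw [← riemannXi_one_sub, ← norm_riemannXi_conj (s := s) (by linarith)]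
  congr 2
  apply Complex.ext
  · simp; linarith
  · simp

/-- The quotient `ξ(s - h) / ξ(s)` grows at most exponentially on the half-plane where it is to be
bounded by the Phragmén–Lindelöf principle. -/
theorem exists_norm_riemannXi_sub_div_le (h0 : ∀ s : ℂ, 1 / 2 < s.re → riemannXi s ≠ 0) {h : ℝ}
    (hh : 0 < h) :
    ∃ K B : ℝ, 0 < B ∧ ∀ s : ℂ, 1 / 2 + h / 2 ≤ s.re →
      ‖riemannXi (s - h) / riemannXi s‖ ≤ K * Real.exp (B * ‖s‖) := by
  obtain ⟨A, hA, hlow⟩ := exists_exp_neg_le_norm_riemannXi h0 (a := 1 / 2 + h / 2) (b := 2 + h)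
    (by linarith) (by linarith) (by linarith)
  obtain ⟨C, hC, hup⟩ := norm_riemannXi_le (1 / 2 - h / 2) 2
  set D := 8 * Real.pi ^ (h / 2) * (Real.Gamma 1 / Real.Gamma (1 + h / 2)) with hD
  have hD0 : 0 ≤ D := by
    have := Real.Gamma_pos_of_pos (show 0 < 1 + h / 2 by linarith)
    have := Real.rpow_pos_of_pos Real.pi_pos (h / 2)
    rw [hD, Real.Gamma_one]
    positivity
  refine ⟨D + C * Real.exp (2 * h + A), A + 2, by linarith, fun s hs => ?_⟩
  rcases le_total (2 + h) s.re with h2 | h2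
  · have h1 : 1 ≤ Real.exp ((A + 2) * ‖s‖) := Real.one_le_exp (by positivity)
    refine (norm_riemannXi_sub_div_le hh le_rfl (by linarith)).trans ?_
    have : 0 ≤ C * Real.exp (2 * h + A) := by positivity
    nlinarith
  · have h1 := hlow s hs h2
    have h3 := hup (s - h) (by simp; linarith) (by simp; linarith)
    have h4 : (1 + ‖s - h‖) ^ 2 ≤ Real.exp (2 * (‖s‖ + h)) := by
      have e : ‖s - h‖ ≤ ‖s‖ + h := by
        simpa [abs_of_pos hh] using norm_sub_le s (h : ℂ)
      have : 1 + ‖s - h‖ ≤ Real.exp (‖s‖ + h) := by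
        linarith [Real.add_one_le_exp (‖s‖ + h)]
      calc (1 + ‖s - h‖) ^ 2 ≤ Real.exp (‖s‖ + h) ^ 2 := by gcongr
        _ = _ := by rw [← Real.exp_nat_mul]; norm_num
    rw [norm_div, div_le_iff₀ ((Real.exp_pos _).trans_le h1)]
    calc ‖riemannXi (s - h)‖ ≤ C * Real.exp (2 * (‖s‖ + h)) := h3.trans (by gcongr)
      _ ≤ C * (Real.exp (2 * h + A) * Real.exp ((A + 2) * ‖s‖) *
          Real.exp (-(A * (1 + |s.im|)))) := by
        rw [← Real.exp_add, ← Real.exp_add]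
        gcongr
        nlinarith [Complex.abs_im_le_norm s]
      _ = (C * Real.exp (2 * h + A)) * Real.exp ((A + 2) * ‖s‖) *
          Real.exp (-(A * (1 + |s.im|))) := by ring
      _ ≤ _ := by
        gcongr
        linarith

/-- If `ξ` has no zeros right of the critical line, then `|ξ|` is larger at the one of two points on
a horizontal line that is further right, as soon as their midpoint is right of the critical line.
The Phragmén–Lindelöf principle gives `≤`, and the maximum modulus principle excludes equality. -/
theorem norm_riemannXi_sub_lt (h0 : ∀ s : ℂ, 1 / 2 < s.re → riemannXi s ≠ 0) {h : ℝ}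
    (hh : 0 < h) {s : ℂ} (hs : 1 / 2 + h / 2 < s.re) : ‖riemannXi (s - h)‖ < ‖riemannXi s‖ := by
  set c : ℝ := 1 / 2 + h / 2 with hc
  set f : ℂ → ℂ := fun z => riemannXi (z + c - h) / riemannXi (z + c) with hf
  have hd : ∀ z : ℂ, 0 ≤ z.re → DifferentiableAt ℂ f z := by
    intro z hz
    have hξ := differentiable_riemannXi
    exact DifferentiableAt.fun_div (by fun_prop) (by fun_prop)
      (h0 _ (by simp only [Complex.add_re, Complex.ofReal_re]; linarith))
  obtain ⟨K, B, hB, hK⟩ := exists_norm_riemannXi_sub_div_le h0 hh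
  have hexp : f =O[Bornology.cobounded ℂ ⊓ 𝓟 {z | 0 < z.re}]
      fun z => Real.exp (B * ‖z‖ ^ (1 : ℝ)) := by
    refine Asymptotics.IsBigO.of_bound (|K| * Real.exp (B * c)) ?_
    refine (eventually_principal.mpr fun (z : ℂ) (hz : 0 < z.re) => ?_).filter_mono inf_le_right
    have h1 := hK (z + c) (by simp only [Complex.add_re, Complex.ofReal_re]; linarith)
    have h2 : ‖z + c‖ ≤ ‖z‖ + c := by
      simpa [abs_of_pos (show 0 < c by linarith)] using norm_add_le z (c : ℂ)
    rw [Real.rpow_one, Real.norm_of_nonneg (Real.exp_pos _).le]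
    calc ‖f z‖ ≤ K * Real.exp (B * ‖z + c‖) := h1
      _ ≤ |K| * Real.exp (B * (‖z‖ + c)) := by
        gcongr
        exact le_abs_self K
      _ = _ := by rw [mul_add, Real.exp_add]; ring
  have hlim : Tendsto (fun x : ℝ => f x) atTop (𝓝 0) := tendsto_riemannXi_sub_div hh
  -- The imaginary axis for `f` is the line `re = c`, where `‖ξ(s - h)‖ = ‖ξ(s)‖`.
  have him : ∀ y : ℝ, ‖f (y * Complex.I)‖ ≤ 1 := by
    intro y
    have hre : (y * Complex.I + c : ℂ).re = c := by simp
    rw [hf, norm_div, norm_riemannXi_sub_eq hh (hre.trans hc)]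
    exact div_self_le_one _
  have hle : ∀ z : ℂ, 0 ≤ z.re → ‖f z‖ ≤ 1 := fun z hz =>
    PhragmenLindelof.right_half_plane_of_tendsto_zero_on_real
      (DifferentiableOn.diffContOnCl fun z hz => (hd z (by
        rw [Complex.closure_setOfPred_lt_re] at hz
        exact hz)).differentiableWithinAt) ⟨1, one_lt_two, B, hexp⟩ hlim him hz
  have hzre : 0 < (s - c).re := by simpa using hs
  have hfs : f (s - c) = riemannXi (s - h) / riemannXi s := by simp [hf]
  have hξs : 0 < ‖riemannXi s‖ := norm_pos_iff.mpr (h0 s (by linarith))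
  -- Equality at an interior point would make `f` constant, but `f` tends to `0` along the reals.
  have hne : ‖f (s - c)‖ ≠ 1 := by
    intro h1
    have hconst := Complex.eqOn_of_isPreconnected_of_isMaxOn_norm
      (convex_halfSpace_re_gt 0).isPreconnected (isOpen_lt continuous_const Complex.continuous_re)
      (fun z (hz : 0 < z.re) => (hd z hz.le).differentiableWithinAt) hzre
      (fun z (hz : 0 < z.re) => by simpa [h1] using hle z hz.le)
    have hlim' : Tendsto (fun x : ℝ => f x) atTop (𝓝 (f (s - c))) :=
      tendsto_const_nhds.congr' (by
        filter_upwards [eventually_gt_atTop 0] with x hx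
        exact (hconst (show 0 < (x : ℂ).re by simpa)).symm)
    rw [tendsto_nhds_unique hlim' hlim, norm_zero] at h1
    exact zero_ne_one h1
  have hlt := lt_of_le_of_ne (hle _ hzre.le) hne
  rwa [hfs, norm_div, div_lt_one hξs] at hlt

/-! ### The equivalence -/

theorem corollary1 :
    List.TFAE
      [∀ t : ℝ, StrictMonoOn (fun σ : ℝ => ‖riemannXi (σ + t * Complex.I)‖) (Set.Ioi (1 / 2)),
       ∀ t : ℝ, StrictAntiOn (fun σ : ℝ => ‖riemannXi (σ + t * Complex.I)‖) (Set.Iio (1 / 2)),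
       ∀ s : ℂ, riemannZeta s = 0 → s.im ≠ 0 → s.re = 1 / 2,
       RiemannHypothesis] := by
  have hrefl : ∀ σ t : ℝ, riemannXi ((1 - σ : ℝ) + (-t : ℝ) * Complex.I) =
      riemannXi (σ + t * Complex.I) := by
    intro σ t
    rw [← riemannXi_one_sub]
    congr 1
    push_cast
    ring
  tfae_have 1 → 2 := by
    intro H t σ₁ h₁ σ₂ h₂ h
    have := H (-t) (a := 1 - σ₂) (b := 1 - σ₁)
      (by simp only [Set.mem_Ioi, Set.mem_Iio] at *; linarith)
      (by simp only [Set.mem_Ioi, Set.mem_Iio] at *; linarith) (by linarith)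
    simpa only [hrefl] using this
  tfae_have 2 → 3 := by
    intro H s hz him
    -- At a zero left of the line, `‖ξ‖` could not decrease further to the right.
    have hno : ∀ w : ℂ, w.re < 1 / 2 → riemannXi w ≠ 0 := by
      intro w hw hw0
      have := H w.im (a := w.re) (b := (w.re + 1 / 2) / 2) hw
        (by simp only [Set.mem_Iio]; linarith) (by linarith)
      simp only [Complex.re_add_im, hw0, norm_zero] at this
      exact (norm_nonneg _).not_gt this
    have hξ : riemannXi s = 0 := riemannXi_eq_zero_of_riemannZeta_eq_zero hz fun n hn => him (by
      rw [hn]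
      simp)
    rcases lt_trichotomy s.re (1 / 2) with h | h | h
    · exact absurd hξ (hno s h)
    · exact h
    · exact absurd ((riemannXi_one_sub s).trans hξ) (hno _ (by simp; linarith))
  tfae_have 3 → 4 := by
    intro H s hz ht h1
    refine H s hz fun him => ?_
    have hξ : riemannXi s = 0 := riemannXi_eq_zero_of_riemannZeta_eq_zero hz fun n hn => ht ⟨n, hn⟩
    have hs : ((s.re : ℝ) : ℂ) = s := Complex.ext rfl (by simp [him])
    rw [← hs] at hξ
    exact riemannXi_ofReal_ne_zero _ hξ
  tfae_have 4 → 1 := by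
    intro H t σ₁ h₁ σ₂ h₂ h
    rw [Set.mem_Ioi] at h₁ h₂
    have h0 : ∀ s : ℂ, 1 / 2 < s.re → riemannXi s ≠ 0 := by
      refine fun s hs => riemannXi_ne_zero (by linarith) fun h1 hz => hs.ne' (H s hz ?_ h1)
      rintro ⟨n, rfl⟩
      have : (-2 * ((n : ℂ) + 1)).re = -2 * ((n : ℝ) + 1) := by simp
      rw [this] at hs
      have : (0 : ℝ) ≤ n := n.cast_nonneg
      linarith
    have := norm_riemannXi_sub_lt h0 (sub_pos.mpr h) (s := σ₂ + t * Complex.I)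
      (by simp; linarith)
    have e : (σ₂ + t * Complex.I - (σ₂ - σ₁ : ℝ) : ℂ) = σ₁ + t * Complex.I := by
      push_cast
      ring
    rwa [e] at this
  tfae_finish
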